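/- **Corollary 3.15.** Let an abstract logic be a triple $\mathcal L=(Expr_{\mathcal L},Th_{\mathcal L},\mathcal C_{\mathcal L})$, where $Expr_{\mathcal L}$ is a set (of expressions), $Th_{\mathcal L}$ is a non-empty set of subsets of $Expr_{\mathcal L}$ (the theories) such that $\bigcap\mathcal T\in Th_{\mathcal L}$ for every non-empty $\mathcal T\subseteq Th_{\mathcal L}$, and $\mathcal C_{\mathcal L}$ is a set of (finitary) operations on $Expr_{\mathcal L}$. A theory $T$ is prime (respectively totally prime) if for every non-empty finite (respectively arbitrary non-empty) set $\mathcal T$ of theories, $T=\bigcap\mathcal T$ implies $T\in\mathcal T$. Expressions $a,b$ are logically equivalent if they belong to the same theories. Call $\mathcal L$ a (bounded) distributive abstract logic if the union of every non-empty chain of theories is a theory; there are binary operations $\vee,\wedge\in\mathcal C_{\mathcal L}$ such that for all expressions $a,b$ and every totally prime theory $T$ one has $a\vee b\in T$ iff $a\in T$ or $b\in T$, and $a\wedge b\in T$ iff $a\in T$ and $b\in T$; some expression $\top$ belongs to every totally prime theory; and some expression $\bot$ belongs to no totally prime theory. A stable logic map $h:\mathcal L\to\mathcal L'$ is a function $h:Expr_{\mathcal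 L}\to Expr_{\mathcal L'}$ such that $h^{-1}(T')$ is a theory of $\mathcal L$ for every theory $T'$ of $\mathcal L'$, and $h^{-1}(P')$ is a prime theory of $\mathcal L$ for every prime theory $P'$ of $\mathcal L'$. Let $\mathcal{LD}$ be the category whose objects are the bounded distributive abstract logics and whose morphisms are the stable logic maps, where equality of expressions is understood as logical equivalence: two stable logic maps $h,g:\mathcal L\to\mathcal L'$ are the same morphism iff $h(a)$ and $g(a)$ are logically equivalent in $\mathcal L'$ for all $a\in Expr_{\mathcal L}$. A Priestley space is a compact topological space with a partial order $\le$ such that whenever $x\not\le y$ there is a clopen upper set containing $x$ but not $y$; morphisms of Priestley spaces are the continuous order-preserving maps. Then $\mathcal{LD}$ is dually equivalent to the category of non-empty Priestley spaces: there is an equivalence of categories between $\mathcal{LD}^{op}$ and the category of non-empty Priestley spaces. -/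

import Mathlib

open CategoryTheory

universe u

/-- An abstract logic: a set of expressions, a non-empty family of theories closed under
non-empty intersections, and a set of (finitary) operations on expressions, the connectives. -/
structure AbstractLogic where
  Expr : Type u
  theories : Set (Set Expr)
  theories_nonempty : theories.Nonempty
  sInter_mem : ∀ 𝒯 : Set (Set Expr), 𝒯 ⊆ theories → 𝒯.Nonempty → ⋂₀ 𝒯 ∈ theories
  connectives : Set (Σ n : ℕ, (Fin n → Expr) → Expr)

namespace AbstractLogic

/-- The consequence relation: `a` lies in every theory that includes `A`. -/
def Entails (L : AbstractLogic.{u}) (A : Set L.Expr) (a : L.Expr) : Prop :=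
  a ∈ ⋂₀ {T | T ∈ L.theories ∧ A ⊆ T}

/-- Logical equivalence of expressions: each one is a consequence of the other. -/
def LogEquiv (L : AbstractLogic.{u}) (a b : L.Expr) : Prop :=
  L.Entails {a} b ∧ L.Entails {b} a

/-- A theory is `κ`-prime if it belongs to every non-empty family of fewer than `κ` theories
whose intersection it is. -/
def IsKPrime (L : AbstractLogic.{u}) (κ : Cardinal.{u}) (T : Set L.Expr) : Prop :=
  T ∈ L.theories ∧ ∀ 𝒯 : Set (Set L.Expr), 𝒯 ⊆ L.theories → 𝒯.Nonempty →
    Cardinal.mk 𝒯 < κ → T = ⋂₀ 𝒯 → T ∈ 𝒯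

/-- Prime theories. -/
def IsPrimeTheory (L : AbstractLogic.{u}) (T : Set L.Expr) : Prop :=
  L.IsKPrime Cardinal.aleph0 T

/-- Totally prime theories. -/
def IsTotallyPrime (L : AbstractLogic.{u}) (T : Set L.Expr) : Prop :=
  ∀ κ : Cardinal.{u}, Cardinal.aleph0 ≤ κ → L.IsKPrime κ T

/-- The union of every non-empty chain of theories is a theory. -/
def ClosedUnderChains (L : AbstractLogic.{u}) : Prop :=
  ∀ 𝒞 : Set (Set L.Expr), 𝒞 ⊆ L.theories → 𝒞.Nonempty → IsChain (· ⊆ ·) 𝒞 →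
    ⋃₀ 𝒞 ∈ L.theories

/-- A binary operation on expressions is one of the connectives. -/
def IsConnective₂ (L : AbstractLogic.{u}) (f : L.Expr → L.Expr → L.Expr) : Prop :=
  (⟨2, fun v => f (v 0) (v 1)⟩ : Σ n : ℕ, (Fin n → L.Expr) → L.Expr) ∈ L.connectives

/-- Distributive abstract logics: closed under unions of chains, with a disjunction and a
conjunction among the connectives. -/
def IsDistributive (L : AbstractLogic.{u}) : Prop :=
  L.ClosedUnderChains ∧
    ∃ disj conj : L.Expr → L.Expr → L.Expr, L.IsConnective₂ disj ∧ L.IsConnective₂ conj ∧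
      ∀ (a b : L.Expr) (T : Set L.Expr), L.IsTotallyPrime T →
        (disj a b ∈ T ↔ a ∈ T ∨ b ∈ T) ∧ (conj a b ∈ T ↔ a ∈ T ∧ b ∈ T)

/-- Some expression lies in every totally prime theory, and some expression lies in none. -/
def IsBounded (L : AbstractLogic.{u}) : Prop :=
  (∃ top : L.Expr, ∀ T, L.IsTotallyPrime T → top ∈ T) ∧
    ∃ bot : L.Expr, ∀ T, L.IsTotallyPrime T → bot ∉ T

/-- Logic maps: functions on expressions along which preimages of theories are theories. -/
def IsLogicMap (L L' : AbstractLogic.{u}) (h : L.Expr → L'.Expr) : Prop :=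
  ∀ T' ∈ L'.theories, h ⁻¹' T' ∈ L.theories

/-- Stable logic maps: in addition, preimages of prime theories are prime theories. -/
structure StableMap (L L' : AbstractLogic.{u}) where
  toFun : L.Expr → L'.Expr
  isLogicMap : IsLogicMap L L' toFun
  stable : ∀ P', L'.IsPrimeTheory P' → L.IsPrimeTheory (toFun ⁻¹' P')

/-- The identity as a stable logic map. -/
def StableMap.id (L : AbstractLogic.{u}) : StableMap L L where
  toFun a := a
  isLogicMap _ h := h
  stable _ h := h

/-- Composition of stable logic maps. -/
def StableMap.comp {L L' L'' : AbstractLogic.{u}} (f : StableMap L L') (g : StableMap L' L'') :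
    StableMap L L'' where
  toFun a := g.toFun (f.toFun a)
  isLogicMap T h := f.isLogicMap _ (g.isLogicMap T h)
  stable P h := f.stable _ (g.stable P h)

theorem LogEquiv.refl {L : AbstractLogic.{u}} (a : L.Expr) : L.LogEquiv a a :=
  ⟨fun _ hT => hT.2 rfl, fun _ hT => hT.2 rfl⟩

theorem LogEquiv.symm {L : AbstractLogic.{u}} {a b : L.Expr} (h : L.LogEquiv a b) :
    L.LogEquiv b a := ⟨h.2, h.1⟩

theorem Entails.trans {L : AbstractLogic.{u}} {a b c : L.Expr} (h : L.Entails {a} b)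
    (h' : L.Entails {b} c) : L.Entails {a} c :=
  fun T hT => h' T ⟨hT.1, Set.singleton_subset_iff.2 (h T hT)⟩

theorem LogEquiv.trans {L : AbstractLogic.{u}} {a b c : L.Expr} (h : L.LogEquiv a b)
    (h' : L.LogEquiv b c) : L.LogEquiv a c :=
  ⟨h.1.trans h'.1, h'.2.trans h.2⟩

theorem Entails.map {L L' : AbstractLogic.{u}} (f : StableMap L L') {a b : L.Expr}
    (h : L.Entails {a} b) : L'.Entails {f.toFun a} (f.toFun b) :=
  fun T hT => h _ ⟨f.isLogicMap T hT.1,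
    Set.singleton_subset_iff.2 (hT.2 rfl)⟩

theorem LogEquiv.map {L L' : AbstractLogic.{u}} (f : StableMap L L') {a b : L.Expr}
    (h : L.LogEquiv a b) : L'.LogEquiv (f.toFun a) (f.toFun b) :=
  ⟨h.1.map f, h.2.map f⟩

/-- Two stable logic maps are identified when their values are logically equivalent: equality of
expressions of an abstract logic is understood as logical equivalence. -/
instance stableMapSetoid (L L' : AbstractLogic.{u}) : Setoid (StableMap L L') where
  r f g := ∀ a, L'.LogEquiv (f.toFun a) (g.toFun a)
  iseqv :=
    { refl := fun _ _ => LogEquiv.refl _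
      symm := fun h a => (h a).symm
      trans := fun h h' a => (h a).trans (h' a) }

end AbstractLogic

/-- The objects of the category of distributive abstract logics: bounded distributive abstract
logics. -/
structure LD where
  logic : AbstractLogic.{u}
  distributive : logic.IsDistributive
  bounded : logic.IsBounded

/-- Morphisms are the stable logic maps, up to logical equivalence of their values. -/
instance LD.category : Category LD.{u} where
  Hom L L' := Quotient (AbstractLogic.stableMapSetoid L.logic L'.logic)
  id L := Quotient.mk _ (AbstractLogic.StableMap.id L.logic)
  comp := Quotient.map₂ AbstractLogic.StableMap.comp
    (fun _ _ hf _ g' hg a => (hg _).trans ((hf a).map g'))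
  id_comp f := Quotient.inductionOn f fun _ => rfl
  comp_id f := Quotient.inductionOn f fun _ => rfl
  assoc f g h := Quotient.inductionOn₃ f g h fun _ _ _ => rfl

/-- Priestley spaces: compact partially ordered spaces such that whenever `¬ x ≤ y` some clopen
upper set contains `x` and not `y`. -/
structure Priest where
  carrier : Type u
  [topology : TopologicalSpace carrier]
  [order : PartialOrder carrier]
  [compact : CompactSpace carrier]
  [priestley : PriestleySpace carrier]

attribute [instance] Priest.topology Priest.order Priest.compact Priest.priestley

/-- Morphisms of Priestley spaces are the continuous order-preserving maps. -/
instance Priest.category : Category Priest.{u} where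
  Hom X Y := X.carrier →Co Y.carrier
  id X := ContinuousOrderHom.id X.carrier
  comp f g := g.comp f

/-- The property of a Priestley space of being non-empty. -/
def Priest.isNonempty : ObjectProperty Priest.{u} := fun X => Nonempty X.carrier

/-!
The duality sends a bounded distributive abstract logic to the space of its prime theories, ordered
by inclusion and topologised by declaring each set `{P | a ∈ P}` clopen, and a stable logic map to
the preimage map on prime theories.

Since theories are closed under unions of chains, Zorn's lemma shows that every theory is the
intersection of the totally prime theories that include it (`exists_isTotallyPrime`). So logical
equivalence is detected by prime theories, which makes the functor faithful, and the behaviour of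
the connectives on totally prime theories carries over to all prime theories.

Compactness of the space of prime theories rests on the fact that every proper filter of expressions
is a theory (`LD.mem_theories_of_filter`). A finite set of expressions generates the same theory
as its conjunction, and an infinite one is the union of a chain of sets of smaller cardinality, so
that an induction on cardinality shows that the theory generated by a subset of the filter stays
inside the filter. Consequently the prime theories are the prime filters, and these form a closed
subset of a power of `Bool`.

Clopen upper sets of the dual space are exactly the sets `{P | a ∈ P}`
(`LD.Spec.exists_eq_of_isClopen`), so a continuous monotone map between dual spaces determines a
map of expressions up to equivalence, whence fullness. Finally a non-empty Priestley space `X` is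
the dual of the logic whose expressions are the clopen upper sets of `X` and whose theories are the
families `{U | C ⊆ U}` with `C ⊆ X` non-empty (`Priest.toLD`); its prime theories are those given
by single points.
-/

open Set

/-! ### Totally prime theories -/

namespace AbstractLogic

variable {L : AbstractLogic.{u}} {T : Set L.Expr} {a : L.Expr}

theorem isTotallyPrime_iff : L.IsTotallyPrime T ↔ T ∈ L.theories ∧
    ∀ 𝒯 : Set (Set L.Expr), 𝒯 ⊆ L.theories → 𝒯.Nonempty → T = ⋂₀ 𝒯 → T ∈ 𝒯 := by
  refine ⟨fun h => ⟨(h _ le_rfl).1, fun 𝒯 h𝒯 hne hT => ?_⟩, fun h κ _ =>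
    ⟨h.1, fun 𝒯 h𝒯 hne _ => h.2 𝒯 h𝒯 hne⟩⟩
  exact (h (max Cardinal.aleph0 (Order.succ (Cardinal.mk 𝒯))) (le_max_left _ _)).2 𝒯 h𝒯 hne
    (lt_max_of_lt_right (Order.lt_succ _)) hT

theorem IsTotallyPrime.isPrimeTheory (h : L.IsTotallyPrime T) : L.IsPrimeTheory T :=
  h _ le_rfl

theorem exists_isTotallyPrime (hc : L.ClosedUnderChains) (hT : T ∈ L.theories) (ha : a ∉ T) :
    ∃ P, L.IsTotallyPrime P ∧ T ⊆ P ∧ a ∉ P := by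
  obtain ⟨M, hTM, hM⟩ := zorn_subset_nonempty {P | P ∈ L.theories ∧ a ∉ P}
    (fun c hcs hchain hne => ⟨⋃₀ c, ⟨hc c (fun P hP => (hcs hP).1) hne hchain, by
      rintro ⟨P, hP, haP⟩
      exact (hcs hP).2 haP⟩, fun P hP => subset_sUnion_of_mem hP⟩) T ⟨hT, ha⟩
  refine ⟨M, isTotallyPrime_iff.2 ⟨hM.prop.1, fun 𝒯 h𝒯 _ hM𝒯 => ?_⟩, hTM, hM.prop.2⟩
  have haM : a ∉ ⋂₀ 𝒯 := hM𝒯 ▸ hM.prop.2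
  obtain ⟨P, hP, haP⟩ : ∃ P ∈ 𝒯, a ∉ P := by simpa [mem_sInter] using haM
  have hMP : M ⊆ P := hM𝒯 ▸ sInter_subset_of_mem hP
  rwa [hM.eq_of_subset ⟨h𝒯 hP, haP⟩ hMP]

/-- Every theory, even the set of all expressions if it is one, extends to a totally prime
theory. -/
theorem exists_isTotallyPrime_superset (hc : L.ClosedUnderChains) (hT : T ∈ L.theories) :
    ∃ P, L.IsTotallyPrime P ∧ T ⊆ P := by
  by_cases h : ∃ a, a ∉ T
  · obtain ⟨a, ha⟩ := h
    obtain ⟨P, hP, hTP, -⟩ := exists_isTotallyPrime hc hT ha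
    exact ⟨P, hP, hTP⟩
  · push Not at h
    refine ⟨T, isTotallyPrime_iff.2 ⟨hT, fun 𝒯 _ ⟨P, hP⟩ hT𝒯 => ?_⟩, subset_rfl⟩
    have hTP : T ⊆ P := hT𝒯 ▸ sInter_subset_of_mem hP
    rwa [hTP.antisymm fun a _ => h a]

end AbstractLogic

/-! ### Theories of distributive logics as filters -/

namespace LD

open AbstractLogic

variable (L : LD.{u})

/-- A disjunction connective of a distributive logic. -/
noncomputable def disj : L.logic.Expr → L.logic.Expr → L.logic.Expr :=
  L.distributive.2.choose

/-- A conjunction connective of a distributive logic. -/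
noncomputable def conj : L.logic.Expr → L.logic.Expr → L.logic.Expr :=
  L.distributive.2.choose_spec.choose

/-- An expression of a bounded logic lying in every totally prime theory. -/
noncomputable def top : L.logic.Expr := L.bounded.1.choose

/-- An expression of a bounded logic lying in no totally prime theory. -/
noncomputable def bot : L.logic.Expr := L.bounded.2.choose

variable {L} {T P F : Set L.logic.Expr} {a b : L.logic.Expr}

theorem disj_mem_iff_of_isTotallyPrime (hT : L.logic.IsTotallyPrime T) :
    L.disj a b ∈ T ↔ a ∈ T ∨ b ∈ T :=
  (L.distributive.2.choose_spec.choose_spec.2.2 a b T hT).1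

theorem conj_mem_iff_of_isTotallyPrime (hT : L.logic.IsTotallyPrime T) :
    L.conj a b ∈ T ↔ a ∈ T ∧ b ∈ T :=
  (L.distributive.2.choose_spec.choose_spec.2.2 a b T hT).2

theorem mem_of_forall_isTotallyPrime (hT : T ∈ L.logic.theories)
    (h : ∀ P, L.logic.IsTotallyPrime P → T ⊆ P → a ∈ P) : a ∈ T := by
  by_contra ha
  obtain ⟨P, hP, hTP, haP⟩ := exists_isTotallyPrime L.distributive.1 hT ha
  exact haP (h P hP hTP)

theorem entails_of_forall_isPrimeTheory
    (h : ∀ P, L.logic.IsPrimeTheory P → a ∈ P → b ∈ P) : L.logic.Entails {a} b :=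
  fun _ hT => mem_of_forall_isTotallyPrime hT.1 fun P hP hTP =>
    h P hP.isPrimeTheory (hTP (hT.2 rfl))

theorem conj_mem_iff (hT : T ∈ L.logic.theories) : L.conj a b ∈ T ↔ a ∈ T ∧ b ∈ T := by
  refine ⟨fun h => ⟨?_, ?_⟩, fun h => ?_⟩ <;>
    refine mem_of_forall_isTotallyPrime hT fun P hP hTP => ?_
  · exact ((conj_mem_iff_of_isTotallyPrime hP).1 (hTP h)).1
  · exact ((conj_mem_iff_of_isTotallyPrime hP).1 (hTP h)).2
  · exact (conj_mem_iff_of_isTotallyPrime hP).2 ⟨hTP h.1, hTP h.2⟩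

theorem top_mem (hT : T ∈ L.logic.theories) : L.top ∈ T :=
  mem_of_forall_isTotallyPrime hT fun P hP _ => L.bounded.1.choose_spec P hP

theorem bot_notMem (hT : T ∈ L.logic.theories) : L.bot ∉ T := fun h => by
  obtain ⟨P, hP, hTP⟩ := exists_isTotallyPrime_superset L.distributive.1 hT
  exact L.bounded.2.choose_spec P hP (hTP h)

theorem disj_mem (hT : T ∈ L.logic.theories) (h : a ∈ T ∨ b ∈ T) : L.disj a b ∈ T :=
  mem_of_forall_isTotallyPrime hT fun _ hP hTP =>
    (disj_mem_iff_of_isTotallyPrime hP).2 (h.imp (fun h => hTP h) fun h => hTP h)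

theorem disj_entails {c : L.logic.Expr} (ha : L.logic.Entails {a} c) (hb : L.logic.Entails {b} c) :
    L.logic.Entails {L.disj a b} c := fun _ hT =>
  mem_of_forall_isTotallyPrime hT.1 fun P hP hTP =>
    ((disj_mem_iff_of_isTotallyPrime hP).1 (hTP (hT.2 rfl))).elim
      (fun h => ha P ⟨hP.isPrimeTheory.1, singleton_subset_iff.2 h⟩)
      fun h => hb P ⟨hP.isPrimeTheory.1, singleton_subset_iff.2 h⟩

/-- If `a ∨ b` lies in a prime theory `P`, then the totally prime theories including `P` split
into those containing `a` and those containing `b`, so that `P` is the intersection of the theories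
generated by `P ∪ {a}` and by `P ∪ {b}`. If neither `a` nor `b` is in `P`, both of these exist. -/
theorem disj_mem_iff (hP : L.logic.IsPrimeTheory P) : L.disj a b ∈ P ↔ a ∈ P ∨ b ∈ P := by
  refine ⟨fun h => ?_, disj_mem hP.1⟩
  by_contra! hab
  obtain ⟨Q, hQ, hPQ, haQ⟩ := exists_isTotallyPrime L.distributive.1 hP.1 hab.1
  obtain ⟨R, hR, hPR, hbR⟩ := exists_isTotallyPrime L.distributive.1 hP.1 hab.2
  have hbQ : b ∈ Q := ((disj_mem_iff_of_isTotallyPrime hQ).1 (hPQ h)).resolve_left haQ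
  have haR : a ∈ R := ((disj_mem_iff_of_isTotallyPrime hR).1 (hPR h)).resolve_right hbR
  -- `I c` is the theory generated by `P ∪ {c}`.
  let I (c : L.logic.Expr) : Set L.logic.Expr :=
    ⋂₀ {S | S ∈ L.logic.theories ∧ P ⊆ S ∧ c ∈ S}
  have hI {c S} (hS : S ∈ L.logic.theories) (hPS : P ⊆ S) (hc : c ∈ S) :
      I c ∈ L.logic.theories :=
    L.logic.sInter_mem _ (fun _ h => h.1) ⟨S, hS, hPS, hc⟩
  have hmem {c} : c ∈ I c := fun S hS => hS.2.2
  have hPI : P = ⋂₀ {I a, I b} := by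
    apply Subset.antisymm
    · rintro x hx S (rfl | rfl) <;> exact fun S hS => hS.2.1 hx
    · intro x hx
      refine mem_of_forall_isTotallyPrime hP.1 fun S hS hPS => ?_
      rcases (disj_mem_iff_of_isTotallyPrime hS).1 (hPS h) with h | h
      · exact hx (I a) (Or.inl rfl) S ⟨hS.isPrimeTheory.1, hPS, h⟩
      · exact hx (I b) (Or.inr rfl) S ⟨hS.isPrimeTheory.1, hPS, h⟩
  have hmemP : P ∈ ({I a, I b} : Set (Set L.logic.Expr)) := by
    refine hP.2 _ ?_ ⟨_, Or.inl rfl⟩ (Cardinal.lt_aleph0_iff_set_finite.2 (toFinite _)) hPI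
    rintro S (rfl | rfl)
    · exact hI hR.isPrimeTheory.1 hPR haR
    · exact hI hQ.isPrimeTheory.1 hPQ hbQ
  rcases hmemP with h | h
  · exact hab.1 (h ▸ hmem)
  · exact hab.2 (h ▸ hmem)

/-- Theories that are prime in the lattice-theoretic sense are meet-irreducible: a disjunction of
expressions outside `T`, one from each member of a finite family, lies in the intersection. -/
theorem isPrimeTheory_of_disj (hT : T ∈ L.logic.theories)
    (h : ∀ a b, L.disj a b ∈ T → a ∈ T ∨ b ∈ T) : L.logic.IsPrimeTheory T := by
  refine ⟨hT, fun 𝒯 h𝒯 _ hfin hT𝒯 => ?_⟩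
  by_contra hmem
  have key : ∃ c, c ∉ T ∧ ∀ S ∈ 𝒯, c ∈ S := by
    refine Set.Finite.induction_on_subset (motive := fun 𝒮 _ => ∃ c, c ∉ T ∧ ∀ S ∈ 𝒮, c ∈ S) 𝒯
      (Cardinal.lt_aleph0_iff_set_finite.1 hfin) ⟨L.bot, bot_notMem hT, by simp⟩ ?_
    rintro S 𝒮 hS h𝒮 - ⟨c, hcT, hc⟩
    have hTS : T ⊆ S := hT𝒯 ▸ sInter_subset_of_mem hS
    obtain ⟨d, hdS, hdT⟩ : ∃ d ∈ S, d ∉ T := by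
      by_contra! hST
      exact hmem (hTS.antisymm hST ▸ hS)
    refine ⟨L.disj c d, fun hcd => (h c d hcd).elim hcT hdT, ?_⟩
    rintro S' (rfl | hS')
    · exact disj_mem (h𝒯 hS) (Or.inr hdS)
    · exact disj_mem (h𝒯 (h𝒮 hS')) (Or.inl (hc S' hS'))
  obtain ⟨c, hcT, hc⟩ := key
  exact hcT (hT𝒯 ▸ hc)

/-- The theory generated by a subset of a proper filter stays inside the filter. -/
theorem exists_theory_between (htop : L.top ∈ F) (hbot : L.bot ∉ F)
    (hconj : ∀ a b, a ∈ F → b ∈ F → L.conj a b ∈ F)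
    (hup : ∀ a b, L.logic.Entails {a} b → a ∈ F → b ∈ F) (S : Set L.logic.Expr) (hSF : S ⊆ F) :
    ∃ T ∈ L.logic.theories, S ⊆ T ∧ T ⊆ F := by
  induction hκ : Cardinal.mk S using WellFoundedLT.induction generalizing S with
  | ind κ ih =>
  subst hκ
  let cl (A : Set L.logic.Expr) : Set L.logic.Expr := ⋂₀ {T | T ∈ L.logic.theories ∧ A ⊆ T}
  have hcl {A : Set L.logic.Expr} : A ⊆ cl A := fun x hx T hT => hT.2 hx
  by_cases hfin : S.Finite
  · have key : ∃ c ∈ F, ∀ T ∈ L.logic.theories, c ∈ T → S ⊆ T := by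
      refine Set.Finite.induction_on_subset
        (motive := fun A _ => ∃ c ∈ F, ∀ T ∈ L.logic.theories, c ∈ T → A ⊆ T) S hfin
        ⟨L.top, htop, by simp⟩ ?_
      rintro a A ha - - ⟨c, hcF, hc⟩
      refine ⟨L.conj a c, hconj a c (hSF ha) hcF, fun T hT hacT => ?_⟩
      obtain ⟨haT, hcT⟩ := (conj_mem_iff hT).1 hacT
      exact insert_subset haT (hc T hT hcT)
    obtain ⟨c, hcF, hc⟩ := key
    -- Some theory contains `c`: otherwise `c` would vacuously entail `⊥`.
    have hne : {T | T ∈ L.logic.theories ∧ {c} ⊆ T}.Nonempty := by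
      by_contra hemp
      rw [not_nonempty_iff_eq_empty] at hemp
      refine hbot (hup c _ ?_ hcF)
      rw [Entails, hemp]
      simp
    have hmem : cl {c} ∈ L.logic.theories := L.logic.sInter_mem _ (fun _ h => h.1) hne
    exact ⟨cl {c}, hmem, hc _ hmem (hcl rfl), fun x hx => hup c x hx hcF⟩
  · have hinf : Cardinal.aleph0 ≤ Cardinal.mk S := Cardinal.infinite_iff.1 (infinite_coe_iff.2 hfin)
    -- In a well-order of least order type, the closed initial segments `A i` have smaller
    -- cardinality than `S`.
    obtain ⟨r, _, hr⟩ := Cardinal.exists_ord_eq S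
    let A (i : S) : Set L.logic.Expr := Subtype.val '' insert i {y : S | r y i}
    have hA (i : S) : ∃ T ∈ L.logic.theories, A i ⊆ T ∧ T ⊆ F := by
      refine ih _ ?_ (A i) ?_ rfl
      · refine (Cardinal.mk_image_le.trans Cardinal.mk_insert_le).trans_lt ?_
        exact Cardinal.add_lt_of_lt hinf (Cardinal.card_typein_lt i hr)
          (Cardinal.one_lt_aleph0.trans_le hinf)
      · rintro _ ⟨y, -, rfl⟩
        exact hSF y.2
    have hclA (i : S) : cl (A i) ∈ L.logic.theories := by
      obtain ⟨T, hT, hAT, -⟩ := hA i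
      exact L.logic.sInter_mem _ (fun _ h => h.1) ⟨T, hT, hAT⟩
    have hclF (i : S) : cl (A i) ⊆ F := by
      obtain ⟨T, hT, hAT, hTF⟩ := hA i
      exact fun x hx => hTF (hx T ⟨hT, hAT⟩)
    have hmono {i j : S} (hij : r i j) : cl (A i) ⊆ cl (A j) := by
      refine fun x hx T hT => hx T ⟨hT.1, fun y hy => hT.2 ?_⟩
      obtain ⟨y, rfl | hy, rfl⟩ := hy
      · exact ⟨y, Or.inr hij, rfl⟩
      · exact ⟨y, Or.inr (_root_.trans hy hij), rfl⟩
    have : Nonempty S := (infinite_coe_iff.2 hfin).nonempty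
    refine ⟨⋃₀ range fun i => cl (A i), L.distributive.1 _ ?_ (range_nonempty _) ?_, ?_, ?_⟩
    · rintro _ ⟨i, rfl⟩
      exact hclA i
    · rintro _ ⟨i, rfl⟩ _ ⟨j, rfl⟩ hne
      rcases trichotomous_of r i j with h | rfl | h
      · exact Or.inl (hmono h)
      · exact absurd rfl hne
      · exact Or.inr (hmono h)
    · exact fun x hx => ⟨_, ⟨⟨x, hx⟩, rfl⟩, hcl ⟨⟨x, hx⟩, Or.inl rfl, rfl⟩⟩
    · rintro x ⟨_, ⟨i, rfl⟩, hx⟩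
      exact hclF i hx

/-- Every proper filter of expressions is a theory. -/
theorem mem_theories_of_filter (htop : L.top ∈ F) (hbot : L.bot ∉ F)
    (hconj : ∀ a b, a ∈ F → b ∈ F → L.conj a b ∈ F)
    (hup : ∀ a b, L.logic.Entails {a} b → a ∈ F → b ∈ F) : F ∈ L.logic.theories := by
  obtain ⟨T, hT, hFT, hTF⟩ := exists_theory_between htop hbot hconj hup F subset_rfl
  exact hFT.antisymm hTF ▸ hT

/-! ### The space of prime theories -/

variable (L) in
/-- The dual space of a logic: its prime theories. -/
@[ext]
structure Spec : Type u where
  theory : Set L.logic.Expr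
  isPrimeTheory : L.logic.IsPrimeTheory theory

namespace Spec

/-- The characteristic function of a prime theory. -/
noncomputable def char (P : L.Spec) (a : L.logic.Expr) : Bool :=
  open Classical in decide (a ∈ P.1)

theorem char_eq_true {P : L.Spec} {a : L.logic.Expr} : P.char a = true ↔ a ∈ P.1 := by
  simp [char]

/-- The topology of pointwise convergence of characteristic functions. -/
noncomputable instance : TopologicalSpace L.Spec := .induced char inferInstance

/-- Prime theories are ordered by inclusion. -/
instance : PartialOrder L.Spec := .lift theory fun _ _ => Spec.ext

theorem continuous_iff {Y : Type*} [TopologicalSpace Y] {f : Y → L.Spec} :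
    Continuous f ↔ ∀ a, IsClopen {y | a ∈ (f y).1} := by
  rw [continuous_induced_rng, continuous_pi_iff]
  refine forall_congr' fun a => ?_
  rw [continuous_bool_rng true]
  refine iff_of_eq (congrArg _ ?_)
  ext y
  exact char_eq_true

theorem isClopen_setOf_mem (a : L.logic.Expr) : IsClopen {P : L.Spec | a ∈ P.1} :=
  continuous_iff.1 continuous_id a

/-- Prime theories are the prime filters, described by closed conditions on characteristic
functions. -/
theorem range_char : range (char : L.Spec → L.logic.Expr → Bool) =
    {f | f L.top = true ∧ f L.bot = false ∧
      (∀ a b, f (L.conj a b) = (f a && f b)) ∧ (∀ a b, f (L.disj a b) = (f a || f b)) ∧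
      ∀ a b, L.logic.Entails {a} b → (f a && f b) = f a} := by
  ext f
  constructor
  · rintro ⟨P, rfl⟩
    have hT := P.2.1
    refine ⟨char_eq_true.2 (top_mem hT), ?_, fun a b => ?_, fun a b => ?_, fun a b h => ?_⟩
    · rw [← Bool.not_eq_true, char_eq_true]
      exact bot_notMem hT
    · rw [Bool.eq_iff_iff, Bool.and_eq_true, char_eq_true, char_eq_true, char_eq_true]
      exact conj_mem_iff hT
    · rw [Bool.eq_iff_iff, Bool.or_eq_true, char_eq_true, char_eq_true, char_eq_true]
      exact disj_mem_iff P.2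
    · rw [Bool.eq_iff_iff, Bool.and_eq_true, char_eq_true, char_eq_true, and_iff_left_iff_imp]
      exact fun ha => h _ ⟨hT, singleton_subset_iff.2 ha⟩
  · rintro ⟨htop, hbot, hconj, hdisj, hent⟩
    have hF : {a | f a = true} ∈ L.logic.theories := by
      refine mem_theories_of_filter htop (by simp [hbot]) (fun a b ha hb => ?_)
        (fun a b hab ha => ?_)
      · simp_all
      · have := hent a b hab
        simp_all
    refine ⟨⟨{a | f a = true}, isPrimeTheory_of_disj hF fun a b hab => ?_⟩, ?_⟩
    · simpa [hdisj] using hab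
    · ext a
      rw [Bool.eq_iff_iff, char_eq_true]
      rfl

instance : CompactSpace L.Spec := by
  have hind : Topology.IsInducing (char : L.Spec → L.logic.Expr → Bool) := ⟨rfl⟩
  have hand (a b : L.logic.Expr) : Continuous fun f : L.logic.Expr → Bool => f a && f b :=
    (continuous_of_discreteTopology (f := fun p : Bool × Bool => p.1 && p.2)).comp'
      (f := fun f : L.logic.Expr → Bool => (f a, f b))
      ((continuous_apply a).prodMk (continuous_apply b))
  have hor (a b : L.logic.Expr) : Continuous fun f : L.logic.Expr → Bool => f a || f b :=
    (continuous_of_discreteTopology (f := fun p : Bool × Bool => p.1 || p.2)).comp'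
      (f := fun f : L.logic.Expr → Bool => (f a, f b))
      ((continuous_apply a).prodMk (continuous_apply b))
  rw [← isCompact_univ_iff, hind.isCompact_iff, image_univ, range_char]
  apply IsClosed.isCompact
  simp only [ofPred_and, ofPred_forall]
  refine (isClosed_eq (continuous_apply _) continuous_const).inter
    ((isClosed_eq (continuous_apply _) continuous_const).inter
      ((isClosed_iInter fun a => isClosed_iInter fun b => ?_).inter
        ((isClosed_iInter fun a => isClosed_iInter fun b => ?_).inter
          (isClosed_iInter fun a => isClosed_iInter fun b => isClosed_iInter fun _ => ?_))))
  · exact isClosed_eq (continuous_apply _) (hand a b)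
  · exact isClosed_eq (continuous_apply _) (hor a b)
  · exact isClosed_eq (hand a b) (continuous_apply _)

instance : PriestleySpace L.Spec where
  priestley {P Q} h := by
    obtain ⟨a, haP, haQ⟩ := not_subset.1 h
    exact ⟨{R | a ∈ R.1}, isClopen_setOf_mem a, fun R S hRS haR => hRS haR, haP, haQ⟩

/-- Two applications of compactness: the complement of `U` gives, for each point of `U`, an
expression whose clopen set lies between that point and `U`; then `U` is covered by finitely many of
these sets. -/
theorem exists_eq_of_isClopen {U : Set L.Spec} (hU : IsClopen U) (hup : IsUpperSet U) :
    ∃ a, U = {P : L.Spec | a ∈ P.1} := by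
  have hpt (P : L.Spec) (hP : P ∈ U) : ∃ a, a ∈ P.1 ∧ ∀ Q ∈ Uᶜ, a ∉ Q.1 := by
    refine hU.compl.isClosed.isCompact.induction_on
      (p := fun s => ∃ a, a ∈ P.1 ∧ ∀ Q ∈ s, a ∉ Q.1) ⟨L.top, top_mem P.2.1, by simp⟩ ?_ ?_ ?_
    · rintro s t hst ⟨a, haP, ha⟩
      exact ⟨a, haP, fun Q hQ => ha Q (hst hQ)⟩
    · rintro s t ⟨a, haP, ha⟩ ⟨b, hbP, hb⟩
      refine ⟨L.conj a b, (conj_mem_iff P.2.1).2 ⟨haP, hbP⟩, ?_⟩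
      rintro Q (hQ | hQ) hab
      · exact ha Q hQ ((conj_mem_iff Q.2.1).1 hab).1
      · exact hb Q hQ ((conj_mem_iff Q.2.1).1 hab).2
    · intro Q hQ
      obtain ⟨a, haP, haQ⟩ := not_subset.1 fun hPQ : P.1 ⊆ Q.1 => hQ (hup hPQ hP)
      exact ⟨{R | a ∈ R.1}ᶜ, mem_nhdsWithin_of_mem_nhds
        ((isClopen_setOf_mem a).compl.isOpen.mem_nhds haQ), a, haP, fun R hR => hR⟩
  have key : ∃ a, (∀ P ∈ U, a ∈ P.1) ∧ ∀ Q ∈ Uᶜ, a ∉ Q.1 := by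
    refine hU.isClosed.isCompact.induction_on
      (p := fun s => ∃ a, (∀ P ∈ s, a ∈ P.1) ∧ ∀ Q ∈ Uᶜ, a ∉ Q.1)
      ⟨L.bot, by simp, fun Q _ => bot_notMem Q.2.1⟩ ?_ ?_ ?_
    · rintro s t hst ⟨a, has, ha⟩
      exact ⟨a, fun P hP => has P (hst hP), ha⟩
    · rintro s t ⟨a, has, ha⟩ ⟨b, hbt, hb⟩
      refine ⟨L.disj a b, ?_, fun Q hQ hab => ((disj_mem_iff Q.2).1 hab).elim (ha Q hQ) (hb Q hQ)⟩
      rintro P (hP | hP)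
      · exact disj_mem P.2.1 (Or.inl (has P hP))
      · exact disj_mem P.2.1 (Or.inr (hbt P hP))
    · intro P hP
      obtain ⟨a, haP, ha⟩ := hpt P hP
      exact ⟨{R | a ∈ R.1}, mem_nhdsWithin_of_mem_nhds
        ((isClopen_setOf_mem a).isOpen.mem_nhds haP), a, fun R hR => hR, ha⟩
  obtain ⟨a, ha, ha'⟩ := key
  exact ⟨a, Subset.antisymm ha fun P haP => by_contra fun hP => ha' P hP haP⟩

instance : Nonempty L.Spec := by
  obtain ⟨T, hT⟩ := L.logic.theories_nonempty
  obtain ⟨P, hP, -⟩ := exists_isTotallyPrime_superset L.distributive.1 hT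
  exact ⟨⟨P, hP.isPrimeTheory⟩⟩

/-- The map of dual spaces given by preimages along a stable logic map. -/
def comap {L L' : LD.{u}} (h : StableMap L.logic L'.logic) : L'.Spec →Co L.Spec where
  toFun P := ⟨h.toFun ⁻¹' P.1, h.stable P.1 P.2⟩
  monotone' _ _ hPQ _ ha := hPQ ha
  continuous_toFun := continuous_iff.2 fun a => isClopen_setOf_mem (h.toFun a)

theorem comap_eq_comap_iff {L L' : LD.{u}} {g h : StableMap L.logic L'.logic} :
    comap g = comap h ↔ ∀ a, L'.logic.LogEquiv (g.toFun a) (h.toFun a) := by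
  constructor
  · intro heq a
    have key (P : L'.Spec) : g.toFun a ∈ P.1 ↔ h.toFun a ∈ P.1 :=
      iff_of_eq (congrArg (fun Q : L.Spec => a ∈ Q.1) (DFunLike.congr_fun heq P))
    exact ⟨entails_of_forall_isPrimeTheory fun P hP => (key ⟨P, hP⟩).1,
      entails_of_forall_isPrimeTheory fun P hP => (key ⟨P, hP⟩).2⟩
  · intro heq
    ext P : 1
    refine Spec.ext (Set.ext fun a => ⟨fun ha => ?_, fun ha => ?_⟩)
    · exact (heq a).1 _ ⟨P.2.1, singleton_subset_iff.2 ha⟩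
    · exact (heq a).2 _ ⟨P.2.1, singleton_subset_iff.2 ha⟩

/-- The preimage under `φ` of the clopen upper set of `a` is the clopen upper set of some
expression `h a`. Preimages along `h` of arbitrary theories are theories because every theory is
an intersection of prime ones. -/
theorem comap_surjective {L L' : LD.{u}} (φ : L'.Spec →Co L.Spec) :
    ∃ h : StableMap L.logic L'.logic, comap h = φ := by
  have hex (a : L.logic.Expr) : ∃ b, φ ⁻¹' {P | a ∈ P.1} = {P | b ∈ P.1} :=
    exists_eq_of_isClopen ((isClopen_setOf_mem a).preimage (map_continuous φ))
      fun P Q hPQ ha => φ.monotone' hPQ ha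
  choose h hh using hex
  have hpre (P : L'.Spec) : h ⁻¹' P.1 = (φ P).1 :=
    Set.ext fun a => (Set.ext_iff.1 (hh a) P).symm
  refine ⟨⟨h, fun T hT => ?_, fun P hP => ?_⟩, ?_⟩
  · have hT' : h ⁻¹' T = ⋂₀ ((fun P : L'.Spec => (φ P).1) '' {P | T ⊆ P.1}) := by
      ext a
      rw [sInter_image, mem_iInter₂]
      refine ⟨fun ha P hTP => (hpre P).subset (hTP ha), fun ha => ?_⟩
      exact mem_of_forall_isTotallyPrime (a := h a) hT fun P hP hTP =>
        (hpre ⟨P, hP.isPrimeTheory⟩).superset (ha ⟨P, hP.isPrimeTheory⟩ hTP)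
    rw [hT']
    obtain ⟨P, hP, hTP⟩ := exists_isTotallyPrime_superset L'.distributive.1 hT
    refine L.logic.sInter_mem _ ?_ ⟨_, ⟨P, hP.isPrimeTheory⟩, hTP, rfl⟩
    rintro _ ⟨Q, -, rfl⟩
    exact (φ Q).2.1
  · exact hpre ⟨P, hP⟩ ▸ (φ ⟨P, hP⟩).2
  · ext P : 1
    exact Spec.ext (hpre P)

end Spec

/-! ### The dual functor -/

/-- The contravariant functor from distributive logics to Priestley spaces. -/
noncomputable def specFunctor : LD.{u}ᵒᵖ ⥤ Priest.{u} where
  obj L := { carrier := L.unop.Spec }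
  map f := Quotient.lift Spec.comap (fun _ _ h => Spec.comap_eq_comap_iff.2 h) f.unop
  map_id _ := rfl
  map_comp f g := by
    obtain ⟨f⟩ := f
    obtain ⟨g⟩ := g
    induction f using Quotient.inductionOn
    induction g using Quotient.inductionOn
    rfl

theorem isNonempty_specFunctor_obj (L : LD.{u}ᵒᵖ) : Priest.isNonempty (specFunctor.obj L) :=
  (inferInstance : Nonempty L.unop.Spec)

instance : specFunctor.{u}.Faithful where
  map_injective {L L'} f g h := by
    obtain ⟨f⟩ := f
    obtain ⟨g⟩ := g
    induction f using Quotient.inductionOn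
    induction g using Quotient.inductionOn
    exact Quiver.Hom.unop_inj (Quotient.sound (Spec.comap_eq_comap_iff.1 h))

instance : specFunctor.{u}.Full where
  map_surjective {L L'} φ := by
    obtain ⟨h, hh⟩ := Spec.comap_surjective (L := L'.unop) (L' := L.unop) φ
    exact ⟨Quiver.Hom.op (Quotient.mk _ h : L'.unop ⟶ L.unop), hh⟩

end LD

/-! ### The logic of clopen upper sets -/

namespace Priest

open AbstractLogic

variable (X : Priest.{u})

/-- The theory of a set of points: the clopen upper sets that include it. -/
def theoryOf (C : Set X.carrier) : Set (ClopenUpperSet X.carrier) :=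
  {U | C ⊆ U}

variable {X} in
theorem sInter_theoryOf (𝒞 : Set (Set X.carrier)) :
    ⋂₀ (X.theoryOf '' 𝒞) = X.theoryOf (⋃₀ 𝒞) := by
  ext U
  simp [theoryOf, sUnion_subset_iff]

/-- The logic of a non-empty Priestley space: expressions are the clopen upper sets and theories
are the theories of non-empty sets of points. -/
abbrev toLogic (hX : Nonempty X.carrier) : AbstractLogic.{u} where
  Expr := ClopenUpperSet X.carrier
  theories := X.theoryOf '' {C | C.Nonempty}
  theories_nonempty := ⟨_, univ, univ_nonempty, rfl⟩
  sInter_mem 𝒯 h𝒯 hne := by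
    obtain ⟨𝒞, h𝒞, rfl⟩ := subset_image_iff.1 h𝒯
    rw [sInter_theoryOf]
    obtain ⟨C, hC⟩ := hne.of_image
    exact ⟨_, (h𝒞 hC).mono (subset_sUnion_of_mem hC), rfl⟩
  connectives := {⟨2, fun v => v 0 ⊔ v 1⟩, ⟨2, fun v => v 0 ⊓ v 1⟩}

variable {X} (hX : Nonempty X.carrier)

theorem theoryOf_singleton_mem (x : X.carrier) : X.theoryOf {x} ∈ (X.toLogic hX).theories :=
  ⟨{x}, singleton_nonempty x, rfl⟩

/-- A theory is totally prime only if it is the theory of a point, because the theory of `C` is the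
intersection of the theories of the points of `C`. -/
theorem exists_eq_theoryOf_singleton {T : Set (ClopenUpperSet X.carrier)}
    (hT : (X.toLogic hX).IsTotallyPrime T) : ∃ x, T = X.theoryOf {x} := by
  obtain ⟨⟨C, hC, rfl⟩, h⟩ := isTotallyPrime_iff.1 hT
  obtain ⟨_, ⟨x, -, rfl⟩, hx⟩ := h (X.theoryOf '' (singleton '' C))
    (by
      rintro _ ⟨_, ⟨x, -, rfl⟩, rfl⟩
      exact theoryOf_singleton_mem hX x)
    ((hC.image _).image _)
    ((congrArg X.theoryOf (by rw [sUnion_image, biUnion_of_singleton])).trans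
      (sInter_theoryOf _).symm)
  exact ⟨x, hx.symm⟩

/-- The union of a chain of theories is the theory of the intersection of the closed sets that they
define, by compactness. -/
theorem toLogic_closedUnderChains : (X.toLogic hX).ClosedUnderChains := by
  intro 𝒯 h𝒯 hne hchain
  let K (T : 𝒯) : Set X.carrier := ⋂ (U : ClopenUpperSet X.carrier) (_ : U ∈ T.1), U
  have hK (T : 𝒯) : IsClosed (K T) := isClosed_biInter fun U _ => U.isClopen.isClosed
  have hmem {T : 𝒯} {U : ClopenUpperSet X.carrier} : U ∈ T.1 ↔ K T ⊆ U := by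
    refine ⟨fun hU => iInter₂_subset U hU, fun hU => ?_⟩
    obtain ⟨C, -, hC⟩ := h𝒯 T.2
    rw [← hC]
    refine Subset.trans (subset_iInter₂ fun V hV => ?_) hU
    rw [← hC] at hV
    exact hV
  have hKne (T : 𝒯) : (K T).Nonempty := by
    obtain ⟨C, hCne, hC⟩ := h𝒯 T.2
    refine hCne.mono (subset_iInter₂ fun V hV => ?_)
    rw [← hC] at hV
    exact hV
  have hdir : Directed (· ⊇ ·) K := fun S T => by
    rcases hchain.total S.2 T.2 with h | h
    · exact ⟨T, biInter_subset_biInter_left h, subset_rfl⟩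
    · exact ⟨S, subset_rfl, biInter_subset_biInter_left h⟩
  have : Nonempty 𝒯 := hne.to_subtype
  refine ⟨⋂ T, K T, IsCompact.nonempty_iInter_of_directed_nonempty_isCompact_isClosed K hdir hKne
    (fun T => (hK T).isCompact) hK, ?_⟩
  ext U
  refine ⟨fun hU => ?_, ?_⟩
  · obtain ⟨T, hT⟩ := exists_subset_nhds_of_isCompact hdir (fun T => (hK T).isCompact)
      fun x hx => U.isClopen.isOpen.mem_nhds (hU hx)
    exact ⟨T, T.2, hmem.2 hT⟩
  · rintro ⟨T, hT, hU⟩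
    exact (iInter_subset K ⟨T, hT⟩).trans (hmem.1 hU)

/-- The bounded distributive logic of clopen upper sets of a non-empty Priestley space. -/
abbrev toLD : LD.{u} where
  logic := X.toLogic hX
  distributive := by
    refine ⟨toLogic_closedUnderChains hX, fun U V : ClopenUpperSet X.carrier => U ⊔ V,
      fun U V : ClopenUpperSet X.carrier => U ⊓ V, Or.inl rfl, Or.inr rfl, fun U V T hT => ?_⟩
    obtain ⟨x, rfl⟩ := exists_eq_theoryOf_singleton hX hT
    constructor
    · exact singleton_subset_iff.trans
        (or_congr singleton_subset_iff.symm singleton_subset_iff.symm)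
    · exact singleton_subset_iff.trans
        (and_congr singleton_subset_iff.symm singleton_subset_iff.symm)
  bounded := by
    refine ⟨⟨(⊤ : ClopenUpperSet X.carrier), fun T hT => ?_⟩,
      ⟨(⊥ : ClopenUpperSet X.carrier), fun T hT => ?_⟩⟩ <;>
      obtain ⟨x, rfl⟩ := exists_eq_theoryOf_singleton hX hT
    · exact subset_univ _
    · exact fun h => h rfl

theorem entails_iff {U V : ClopenUpperSet X.carrier} :
    (toLD hX).logic.Entails {U} V ↔ (U : Set X.carrier) ⊆ V := by
  constructor
  · intro h x hx
    exact h (X.theoryOf {x}) ⟨theoryOf_singleton_mem hX x,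
      singleton_subset_iff.2 (singleton_subset_iff.2 hx)⟩ rfl
  · rintro h _ ⟨⟨C, -, rfl⟩, hC⟩
    exact Subset.trans (hC rfl) h

theorem mem_theoryOf_singleton {x : X.carrier} {U : ClopenUpperSet X.carrier} :
    U ∈ X.theoryOf {x} ↔ x ∈ (U : Set X.carrier) := singleton_subset_iff

theorem isPrimeTheory_theoryOf_singleton (x : X.carrier) :
    (toLD hX).logic.IsPrimeTheory (X.theoryOf {x}) := by
  refine LD.isPrimeTheory_of_disj (theoryOf_singleton_mem hX x) fun U V hUV => ?_
  have hsup : (toLD hX).logic.Entails {(toLD hX).disj U V} (U ⊔ V : ClopenUpperSet X.carrier) :=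
    LD.disj_entails ((entails_iff hX).2 subset_union_left) ((entails_iff hX).2 subset_union_right)
  exact ((entails_iff hX).1 hsup (mem_theoryOf_singleton.1 hUV)).imp
    mem_theoryOf_singleton.2 mem_theoryOf_singleton.2

/-- If no point has theory `P`, then each point has a neighbourhood on which some member of `P` is
below some non-member; by compactness the same holds on the whole space, which contradicts that
theories are closed under consequence. -/
theorem exists_eq_theoryOf_singleton_of_isPrimeTheory {P : Set (ClopenUpperSet X.carrier)}
    (hP : (toLD hX).logic.IsPrimeTheory P) : ∃ x, X.theoryOf {x} = P := by
  by_contra! hne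
  have hmem {U V : ClopenUpperSet X.carrier} (hUV : (toLD hX).logic.Entails {U} V)
      (hU : U ∈ P) : V ∈ P := hUV P ⟨hP.1, singleton_subset_iff.2 hU⟩
  have key : ∃ U V : ClopenUpperSet X.carrier, U ∈ P ∧ V ∉ P ∧ ∀ x ∈ univ, x ∈ U → x ∈ V := by
    refine isCompact_univ.induction_on (p := fun s => ∃ U V : ClopenUpperSet X.carrier,
      U ∈ P ∧ V ∉ P ∧ ∀ x ∈ s, x ∈ U → x ∈ V) ?_ ?_ ?_ ?_
    · exact ⟨_, _, LD.top_mem hP.1, LD.bot_notMem hP.1, by simp⟩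
    · rintro s t hst ⟨U, V, hU, hV, h⟩
      exact ⟨U, V, hU, hV, fun x hx => h x (hst hx)⟩
    · rintro s t ⟨U, V, hU, hV, h⟩ ⟨U', V', hU', hV', h'⟩
      refine ⟨_, _, (LD.conj_mem_iff hP.1).2 ⟨hU, hU'⟩,
        fun h => ((LD.disj_mem_iff hP).1 h).elim hV hV', ?_⟩
      rintro x hx hxU
      have hT := theoryOf_singleton_mem hX x
      obtain ⟨hxU, hxU'⟩ := (LD.conj_mem_iff (L := toLD hX) hT).1 (mem_theoryOf_singleton.2 hxU)
      refine mem_theoryOf_singleton.1 (LD.disj_mem (L := toLD hX) hT (hx.imp (fun hx => ?_)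
        fun hx => ?_))
      · exact mem_theoryOf_singleton.2 (h x hx (mem_theoryOf_singleton.1 hxU))
      · exact mem_theoryOf_singleton.2 (h' x hx (mem_theoryOf_singleton.1 hxU'))
    · intro x _
      obtain ⟨U, hU⟩ : ∃ U : ClopenUpperSet X.carrier, ¬(U ∈ X.theoryOf {x} ↔ U ∈ P) := by
        by_contra! h
        exact hne x (Set.ext h)
      rw [mem_theoryOf_singleton] at hU
      by_cases hUP : U ∈ P
      · refine ⟨(U : Set X.carrier)ᶜ, mem_nhdsWithin_of_mem_nhds
          (U.isClopen.compl.isOpen.mem_nhds (by simpa [hUP] using hU)), U, _, hUP,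
          LD.bot_notMem hP.1, fun y hy hyU => absurd hyU hy⟩
      · refine ⟨(U : Set X.carrier), mem_nhdsWithin_of_mem_nhds
          (U.isClopen.isOpen.mem_nhds (by simpa [hUP] using hU)), _, U, LD.top_mem hP.1,
          hUP, fun y hy _ => hy⟩
  obtain ⟨U, V, hU, hV, h⟩ := key
  exact hV (hmem ((entails_iff hX).2 fun x => h x trivial) hU)

/-- A point of a Priestley space as a point of the dual space of its logic. -/
def toSpec (x : X.carrier) : (toLD hX).Spec :=
  ⟨X.theoryOf {x}, isPrimeTheory_theoryOf_singleton hX x⟩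

theorem toSpec_le_toSpec {x y : X.carrier} : toSpec hX x ≤ toSpec hX y ↔ x ≤ y := by
  refine ⟨fun h => ?_, fun h U hU => ?_⟩
  · by_contra hxy
    obtain ⟨U, hU, hup, hx, hy⟩ := exists_isClopen_upper_of_not_le hxy
    exact hy (mem_theoryOf_singleton.1
      (h (mem_theoryOf_singleton.2 hx : (⟨⟨U, hU⟩, hup⟩ : ClopenUpperSet X.carrier) ∈ _)))
  · exact mem_theoryOf_singleton.2 (U.upper h (mem_theoryOf_singleton.1 hU))

theorem continuous_toSpec : Continuous (toSpec hX) :=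
  LD.Spec.continuous_iff.2 fun U : ClopenUpperSet X.carrier => by
    convert U.isClopen using 1
    ext x
    exact mem_theoryOf_singleton

theorem bijective_toSpec : Function.Bijective (toSpec hX) := by
  refine ⟨fun x y h => ?_, fun P => ?_⟩
  · exact le_antisymm ((toSpec_le_toSpec hX).1 h.le) ((toSpec_le_toSpec hX).1 h.ge)
  · obtain ⟨x, hx⟩ := exists_eq_theoryOf_singleton_of_isPrimeTheory hX P.2
    exact ⟨x, LD.Spec.ext hx⟩

/-- A non-empty Priestley space is homeomorphic to the dual space of its logic. -/
noncomputable def homeomorphSpec : X.carrier ≃ₜ (toLD hX).Spec :=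
  Continuous.homeoOfEquivCompactToT2 (f := Equiv.ofBijective _ (bijective_toSpec hX))
    (continuous_toSpec hX)

/-- A non-empty Priestley space is isomorphic to the dual space of its logic. -/
noncomputable def isoSpec : LD.specFunctor.obj (Opposite.op (toLD hX)) ≅ X where
  hom :=
    { toFun := (homeomorphSpec hX).symm
      monotone' := fun P Q hPQ => by
        rw [← toSpec_le_toSpec hX]
        exact ((homeomorphSpec hX).apply_symm_apply P).le.trans
          (hPQ.trans ((homeomorphSpec hX).apply_symm_apply Q).ge)
      continuous_toFun := (homeomorphSpec hX).symm.continuous }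
  inv :=
    { toFun := toSpec hX
      monotone' := fun _ _ => (toSpec_le_toSpec hX).2
      continuous_toFun := continuous_toSpec hX }
  hom_inv_id := ContinuousOrderHom.ext (homeomorphSpec hX).apply_symm_apply
  inv_hom_id := ContinuousOrderHom.ext (homeomorphSpec hX).symm_apply_apply

end Priest

theorem corollary3p15 : Nonempty (LD.{u}ᵒᵖ ≌ Priest.isNonempty.{u}.FullSubcategory) := by
  let F : LD.{u}ᵒᵖ ⥤ Priest.isNonempty.{u}.FullSubcategory :=
    Priest.isNonempty.lift LD.specFunctor LD.isNonempty_specFunctor_obj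
  have : F.Faithful := inferInstanceAs
    (Priest.isNonempty.lift LD.specFunctor LD.isNonempty_specFunctor_obj).Faithful
  have : F.Full := inferInstanceAs
    (Priest.isNonempty.lift LD.specFunctor LD.isNonempty_specFunctor_obj).Full
  have : F.EssSurj := ⟨fun X => ⟨Opposite.op (Priest.toLD X.property),
    ⟨Priest.isNonempty.isoMk (Priest.isoSpec X.property)⟩⟩⟩
  have : F.IsEquivalence := {}
  exact ⟨F.asEquivalence⟩
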